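/- For complex $a,q$ let $(a;q)_n=\prod_{i=0}^{n-1}(1-aq^i)$ and, when $|q|<1$, $(a;q)_\infty=\prod_{i=0}^{\infty}(1-aq^i)$. Let $$\psi(\alpha;q)=\sum_{n=1}^\infty \frac{q^{n^2}}{(\alpha;q^2)_n}.$$ Let $P_{do}$ be the set of nonempty integer partitions into distinct parts whose smallest part is odd; for $\nu\in P_{do}$ let $l(\nu)$ be its number of parts and $|\nu|$ the sum of its parts. **Theorem.** Let $\alpha,q\in\mathbb{C}$ with $|q|<1$ and $1+\alpha q^{2n+1}\neq 0$ for all integers $n\ge 0$ (so that every term of $\psi(-\alpha q;-q)$ is defined). Then the infinite product and all the series below converge (the series absolutely), and $$(-\alpha;q)_\infty\,\psi(-\alpha q;-q)=-\sum_{\nu\in P_{do}}\alpha^{l(\nu)}q^{|\nu|}+\sum_{k=1}^\infty(-1)^kq^{k^2}.$$ -/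

import Mathlib

/-- The finite shifted factorial `(a;q)_n = (1-a)(1-aq)⋯(1-aq^{n-1})`. -/
noncomputable def qPoch (a q : ℂ) (n : ℕ) : ℂ :=
  ∏ i ∈ Finset.range n, (1 - a * q ^ i)

/-- The infinite shifted factorial `(a;q)_∞ = ∏_{n ≥ 0} (1-aq^n)`. -/
noncomputable def qPochInf (a q : ℂ) : ℂ :=
  ∏' i : ℕ, (1 - a * q ^ i)

/-- The summand `q^{n²} / (α;q²)_n` of `ψ(α;q)`. -/
noncomputable def psiTerm (α q : ℂ) (n : ℕ) : ℂ :=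
  q ^ (n ^ 2) / qPoch α (q ^ 2) n

/-- The generalized mock theta function `ψ(α;q) = ∑_{n ≥ 1} q^{n²} / (α;q²)_n`. -/
noncomputable def psi (α q : ℂ) : ℂ :=
  ∑' n : ℕ, psiTerm α q (n + 1)

/-- `P_do`: the set of all (nonempty) integer partitions, of any size, into distinct parts
whose smallest part is odd. A partition is a pair of its size and the partition itself. -/
def Pdo : Set (Σ n : ℕ, n.Partition) :=
  {ν | ν.2.parts.Nodup ∧ ∃ s ∈ ν.2.parts, (∀ t ∈ ν.2.parts, s ≤ t) ∧ Odd s}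

/-- The size `|ν|`, the sum of the parts. -/
def partitionSize (ν : Σ n : ℕ, n.Partition) : ℕ := ν.2.parts.sum

/-- The length `l(ν)`, the number of parts. -/
def partitionLength (ν : Σ n : ℕ, n.Partition) : ℕ := Multiset.card ν.2.parts

/-!
Write `F(α) = (-α;q)_∞` and `S(α) = ψ(-αq;-q)`. The terms `t_n(α)` of `S(α)` satisfy
`t_n(αq²) = (1 + αq) (t_n(α) + α t_{n+1}(α))` (`psiTerm_shift`), and summation over `n ≥ 1` gives
`S(αq²) = (1 + α)(1 + αq) S(α) + αq` (`psi_shift`). Multiplying by `F(αq²)`, where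
`F(α) = (1 + α)(1 + αq) F(αq²)`, one finds that `H = F S` obeys
`H(αq²) - H(α) = αq F(αq²)`. Iteration telescopes (`sum_range_mul_qPochInf`):
`∑_{m<N} αq^{2m+1} F(αq^{2m+2}) = H(αq^{2N}) - H(α)`.

As `N → ∞`, dominated convergence gives `F(αq^{2N}) → 1` and `S(αq^{2N}) → ∑_{k≥1} (-1)^k q^{k²}`.
The domination is crude: the factors `1 + αq^{2n+1}` are bounded away from `0`, hence
`|t_n(αq^{2N})| ≤ |q|^{n²} C^n` with `C` independent of `N`.

On the left, `αq^{2m+1} F(αq^{2m+2})` is the generating function of the partitions into distinct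
parts with smallest part `2m+1`, as one sees by expanding the infinite product into a sum over
finite sets of further parts (`hasSum_mul_qPochInf`). The limit of the left side is therefore the
sum over `P_do`.
-/

open Filter Topology

/-! ### Convergence -/

theorem summable_pow_sq_mul_pow {r : ℝ} (hr0 : 0 ≤ r) (hr : r < 1) (C : ℝ) :
    Summable fun n : ℕ => r ^ (n ^ 2) * C ^ n := by
  have hlim : Tendsto (fun n : ℕ => ‖r ^ n * C‖) atTop (𝓝 0) := by
    simpa using ((tendsto_pow_atTop_nhds_zero_of_lt_one hr0 hr).mul_const C).norm
  refine Summable.of_norm_bounded_eventually_nat (summable_geometric_two) ?_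
  filter_upwards [hlim.eventually_le_const (show (0 : ℝ) < 1 / 2 by norm_num)] with n hn
  calc ‖r ^ (n ^ 2) * C ^ n‖ = ‖r ^ n * C‖ ^ n := by
        rw [← norm_pow, mul_pow, ← pow_mul, sq]
    _ ≤ (1 / 2) ^ n := pow_le_pow_left₀ (norm_nonneg _) hn n

theorem summable_norm_mul_pow {q : ℂ} (hq : ‖q‖ < 1) (x : ℂ) :
    Summable fun n : ℕ => ‖x * q ^ n‖ := by
  simpa using (summable_geometric_of_lt_one (norm_nonneg q) hq).mul_left ‖x‖

theorem multipliable_one_sub_neg_mul_pow {q : ℂ} (hq : ‖q‖ < 1) (x : ℂ) :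
    Multipliable fun n : ℕ => 1 - (-x) * q ^ n := by
  simpa using multipliable_one_add_of_summable (summable_norm_mul_pow hq x)

theorem qPochInf_neg (x q : ℂ) : qPochInf (-x) q = ∏' n : ℕ, (1 + x * q ^ n) := by
  simp [qPochInf]

theorem qPochInf_neg_eq_mul {q : ℂ} (hq : ‖q‖ < 1) (x : ℂ) :
    qPochInf (-x) q = (1 + x) * (1 + x * q) * qPochInf (-(x * q ^ 2)) q := by
  have h := (multipliable_one_sub_neg_mul_pow hq (x * q ^ 2))
  have h2 : Multipliable fun n : ℕ => 1 - (-x) * q ^ (n + 2) := by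
    refine h.congr fun n => ?_
    ring
  have hsplit := h2.prod_mul_tprod_nat_mul' (f := fun n : ℕ => 1 - (-x) * q ^ n)
  have htail : ∏' n : ℕ, (1 - (-x) * q ^ (n + 2)) = qPochInf (-(x * q ^ 2)) q :=
    tprod_congr fun n => by ring
  rw [qPochInf, ← hsplit, htail]
  simp [Finset.prod_range_succ]

theorem tendsto_qPochInf_neg {q : ℂ} (hq : ‖q‖ < 1) {u : ℕ → ℂ}
    (hu : Tendsto u atTop (𝓝 0)) :
    Tendsto (fun N => qPochInf (-u N) q) atTop (𝓝 1) := by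
  have h := tendsto_tprod_one_add_of_dominated_convergence (𝓕 := atTop)
    (f := fun N n : ℕ => u N * q ^ n) (g := fun _ => 0)
    (summable_norm_mul_pow hq 1) (fun k => by simpa using hu.mul_const (q ^ k))
    (by
      filter_upwards [hu.norm.eventually_le_const (show ‖(0 : ℂ)‖ < 1 by simp)] with N hN k
      rw [norm_mul, norm_mul, norm_one]
      gcongr)
  simpa [qPochInf_neg] using h

theorem psiTerm_eq (x q : ℂ) (n : ℕ) :
    psiTerm (-x * q) (-q) n =
      (-1) ^ n * q ^ (n ^ 2) * ∏ i ∈ Finset.range n, (1 + x * q ^ (2 * i + 1))⁻¹ := by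
  have hsign : (-q) ^ (n ^ 2) = (-1) ^ n * q ^ (n ^ 2) := by
    rw [neg_pow, sq, pow_mul]
    rcases Nat.even_or_odd n with h | h <;> simp [h.neg_one_pow]
  rw [psiTerm, qPoch, hsign, div_eq_mul_inv, Finset.prod_inv_distrib]
  congr 2
  refine Finset.prod_congr rfl fun i _ => ?_
  rw [neg_sq]
  ring

/-- The factors `1 + αq^{2n+1}` tend to `1`, so their inverses are bounded. A vanishing factor does
no harm, as its inverse is then `0`. -/
theorem exists_norm_inv_one_add_le {q : ℂ} (hq : ‖q‖ < 1) (α : ℂ) :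
    ∃ C : ℝ, ∀ n : ℕ, ‖(1 + α * q ^ (2 * n + 1))⁻¹‖ ≤ C := by
  have hpow : Tendsto (fun n : ℕ => q ^ (2 * n + 1)) atTop (𝓝 0) :=
    (tendsto_pow_atTop_nhds_zero_of_norm_lt_one hq).comp
      (tendsto_atTop_mono (fun n : ℕ => by lia : ∀ n : ℕ, n ≤ 2 * n + 1) tendsto_id)
  have hlim : Tendsto (fun n : ℕ => ‖(1 + α * q ^ (2 * n + 1))⁻¹‖) atTop (𝓝 1) := by
    have h : Tendsto (fun n : ℕ => 1 + α * q ^ (2 * n + 1)) atTop (𝓝 1) := by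
      simpa using (hpow.const_mul α).const_add 1
    simpa using (h.inv₀ one_ne_zero).norm
  obtain ⟨C, hC⟩ := hlim.bddAbove_range
  exact ⟨C, fun n => hC ⟨n, rfl⟩⟩

/-- One bound serves all the shifts `α ↦ α q^{2N}`, whose denominators are among those of `α`. -/
theorem norm_psiTerm_shift_le {α q : ℂ} {C : ℝ}
    (hC : ∀ n : ℕ, ‖(1 + α * q ^ (2 * n + 1))⁻¹‖ ≤ C) (N n : ℕ) :
    ‖psiTerm (-(α * q ^ (2 * N)) * q) (-q) n‖ ≤ ‖q‖ ^ (n ^ 2) * C ^ n := by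
  rw [psiTerm_eq, norm_mul, norm_mul, norm_pow, norm_pow, norm_neg, norm_one, one_pow, one_mul,
    norm_prod]
  gcongr
  calc _ ≤ ∏ _i ∈ Finset.range n, C := by
        refine Finset.prod_le_prod (fun _ _ => norm_nonneg _) fun i _ => ?_
        have h : α * q ^ (2 * N) * q ^ (2 * i + 1) = α * q ^ (2 * (N + i) + 1) := by ring
        rw [h]
        exact hC (N + i)
    _ = C ^ n := by simp

theorem summable_psiTerm {q : ℂ} (hq : ‖q‖ < 1) (α : ℂ) :
    Summable fun n : ℕ => psiTerm (-α * q) (-q) n := by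
  obtain ⟨C, hC⟩ := exists_norm_inv_one_add_le hq α
  refine (summable_pow_sq_mul_pow (norm_nonneg q) hq C).of_norm_bounded fun n => ?_
  simpa using norm_psiTerm_shift_le hC 0 n

theorem tendsto_mul_pow_two_mul {q : ℂ} (hq : ‖q‖ < 1) (α : ℂ) :
    Tendsto (fun N : ℕ => α * q ^ (2 * N)) atTop (𝓝 0) := by
  simpa using ((tendsto_pow_atTop_nhds_zero_of_norm_lt_one hq).comp
    (tendsto_atTop_mono (fun n : ℕ => by lia : ∀ n : ℕ, n ≤ 2 * n) tendsto_id)).const_mul α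

theorem tendsto_psi_shift {q : ℂ} (hq : ‖q‖ < 1) (α : ℂ) :
    Tendsto (fun N : ℕ => psi (-(α * q ^ (2 * N)) * q) (-q)) atTop
      (𝓝 (∑' k : ℕ, (-1 : ℂ) ^ (k + 1) * q ^ ((k + 1) ^ 2))) := by
  obtain ⟨C, hC⟩ := exists_norm_inv_one_add_le hq α
  refine tendsto_tsum_of_dominated_convergence
    ((summable_nat_add_iff 1).2 (summable_pow_sq_mul_pow (norm_nonneg q) hq C)) (fun k => ?_)
    (Eventually.of_forall fun N k => norm_psiTerm_shift_le hC N (k + 1))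
  simp_rw [psiTerm_eq]
  have hprod : Tendsto (fun N : ℕ => ∏ i ∈ Finset.range (k + 1),
      (1 + α * q ^ (2 * N) * q ^ (2 * i + 1))⁻¹) atTop
      (𝓝 (∏ _i ∈ Finset.range (k + 1), (1 : ℂ))) := by
    refine tendsto_finsetProd _ fun i _ => ?_
    have h : Tendsto (fun N : ℕ => 1 + α * q ^ (2 * N) * q ^ (2 * i + 1)) atTop (𝓝 1) := by
      simpa using ((tendsto_mul_pow_two_mul hq α).mul_const (q ^ (2 * i + 1))).const_add 1
    simpa using h.inv₀ one_ne_zero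
  simpa using hprod.const_mul ((-1) ^ (k + 1) * q ^ ((k + 1) ^ 2))

/-! ### The functional equation -/

theorem psiTerm_shift {α q : ℂ} (hα : ∀ n : ℕ, 1 + α * q ^ (2 * n + 1) ≠ 0) (n : ℕ) :
    psiTerm (-(α * q ^ 2) * q) (-q) n =
      (1 + α * q) * (psiTerm (-α * q) (-q) n + α * psiTerm (-α * q) (-q) (n + 1)) := by
  have h0 : 1 + α * q ≠ 0 := by simpa using hα 0
  have hshift : (∏ i ∈ Finset.range n, (1 + α * q ^ 2 * q ^ (2 * i + 1))⁻¹) =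
      (1 + α * q) * ∏ i ∈ Finset.range (n + 1), (1 + α * q ^ (2 * i + 1))⁻¹ := by
    rw [Finset.prod_range_succ']
    simp only [mul_zero, zero_add, pow_one]
    rw [mul_left_comm, mul_inv_cancel₀ h0, mul_one]
    exact Finset.prod_congr rfl fun i _ => by ring_nf
  rw [psiTerm_eq, psiTerm_eq, psiTerm_eq, hshift, Finset.prod_range_succ]
  have hn := hα n
  generalize (∏ i ∈ Finset.range n, (1 + α * q ^ (2 * i + 1))⁻¹) = P
  field_simp
  ring

/-- The functional equation relating `ψ(-αq;-q)` with its value at `αq²`. -/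
theorem psi_shift {α q : ℂ} (hq : ‖q‖ < 1) (hα : ∀ n : ℕ, 1 + α * q ^ (2 * n + 1) ≠ 0) :
    psi (-(α * q ^ 2) * q) (-q) = (1 + α) * (1 + α * q) * psi (-α * q) (-q) + α * q := by
  have hs := summable_psiTerm hq α
  have hs1 := (summable_nat_add_iff 1).2 hs
  have hs2 := (summable_nat_add_iff 2).2 hs
  have h0 : 1 + α * q ≠ 0 := by simpa using hα 0
  have hfirst : psiTerm (-α * q) (-q) 1 = -q / (1 + α * q) := by
    rw [psiTerm_eq]
    simp [div_eq_mul_inv]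
  have htail : psi (-α * q) (-q) =
      psiTerm (-α * q) (-q) 1 + ∑' n : ℕ, psiTerm (-α * q) (-q) (n + 2) := by
    rw [psi, hs1.tsum_eq_zero_add]
  have hsum : psi (-(α * q ^ 2) * q) (-q) = (1 + α * q) *
      (psi (-α * q) (-q) + α * ∑' n : ℕ, psiTerm (-α * q) (-q) (n + 2)) := by
    rw [psi, psi, tsum_congr fun n => psiTerm_shift hα (n + 1), tsum_mul_left,
      hs1.tsum_add (hs2.mul_left α), tsum_mul_left]
  rw [hsum, ← sub_eq_iff_eq_add'.2 htail, hfirst]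
  field_simp
  ring

/-- Summing the functional equation over `α, αq², αq⁴, …` telescopes. -/
theorem sum_range_mul_qPochInf {α q : ℂ} (hq : ‖q‖ < 1)
    (hα : ∀ n : ℕ, 1 + α * q ^ (2 * n + 1) ≠ 0) (N : ℕ) :
    ∑ m ∈ Finset.range N, α * q ^ (2 * m + 1) * qPochInf (-(α * q ^ (2 * m + 2))) q =
      qPochInf (-(α * q ^ (2 * N))) q * psi (-(α * q ^ (2 * N)) * q) (-q) -
        qPochInf (-α) q * psi (-α * q) (-q) := by
  induction N with
  | zero => simp
  | succ N ih =>
    have hN : ∀ n : ℕ, 1 + α * q ^ (2 * N) * q ^ (2 * n + 1) ≠ 0 := fun n => by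
      convert hα (N + n) using 2
      ring
    have hpsi := psi_shift hq hN
    have hprod := qPochInf_neg_eq_mul hq (α * q ^ (2 * N))
    have hexp : α * q ^ (2 * (N + 1)) = α * q ^ (2 * N) * q ^ 2 := by ring
    have hexp2 : α * q ^ (2 * N + 2) = α * q ^ (2 * N) * q ^ 2 := by ring
    rw [Finset.sum_range_succ, ih, hexp, hexp2, hpsi, hprod]
    ring

theorem tendsto_sum_range_mul_qPochInf {α q : ℂ} (hq : ‖q‖ < 1)
    (hα : ∀ n : ℕ, 1 + α * q ^ (2 * n + 1) ≠ 0) :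
    Tendsto (fun N => ∑ m ∈ Finset.range N,
        α * q ^ (2 * m + 1) * qPochInf (-(α * q ^ (2 * m + 2))) q) atTop
      (𝓝 ((∑' k : ℕ, (-1 : ℂ) ^ (k + 1) * q ^ ((k + 1) ^ 2)) -
        qPochInf (-α) q * psi (-α * q) (-q))) := by
  simp_rw [sum_range_mul_qPochInf hq hα]
  simpa using ((tendsto_qPochInf_neg hq (tendsto_mul_pow_two_mul hq α)).mul
    (tendsto_psi_shift hq α)).sub_const (qPochInf (-α) q * psi (-α * q) (-q))

/-! ### Partitions into distinct parts with odd smallest part -/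

/-- The parts of the partition with smallest part `2m+1` whose other parts are `i+2m+2`, `i ∈ s`. -/
def oddMinParts (p : ℕ × Finset ℕ) : Multiset ℕ :=
  (2 * p.1 + 1) ::ₘ p.2.val.map (· + (2 * p.1 + 2))

theorem le_of_mem_oddMinParts {p : ℕ × Finset ℕ} {t : ℕ} (ht : t ∈ oddMinParts p) :
    2 * p.1 + 1 ≤ t := by
  simp only [oddMinParts, Multiset.mem_cons, Multiset.mem_map] at ht
  lia

theorem nodup_oddMinParts (p : ℕ × Finset ℕ) : (oddMinParts p).Nodup := by
  refine Multiset.nodup_cons.2 ⟨fun h => ?_, p.2.nodup.map (add_left_injective _)⟩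
  obtain ⟨i, -, hi⟩ := Multiset.mem_map.1 h
  lia

theorem oddMinParts_injective : Function.Injective oddMinParts := by
  rintro ⟨m, s⟩ ⟨m', s'⟩ h
  have h1 : 2 * m' + 1 ≤ 2 * m + 1 :=
    le_of_mem_oddMinParts (p := (m', s')) (h ▸ Multiset.mem_cons_self _ _)
  have h2 : 2 * m + 1 ≤ 2 * m' + 1 :=
    le_of_mem_oddMinParts (p := (m, s)) (h ▸ Multiset.mem_cons_self _ _)
  obtain rfl : m = m' := by lia
  have h3 := Multiset.map_injective (add_left_injective (2 * m + 2))
    ((Multiset.cons_inj_right (2 * m + 1)).1 h)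
  exact Prod.ext rfl (Finset.val_inj.1 h3)

/-- The element of `P_do` with parts `oddMinParts p`. -/
def pdoOfPair (p : ℕ × Finset ℕ) : Pdo :=
  ⟨⟨(oddMinParts p).sum, oddMinParts p, fun ht => by have := le_of_mem_oddMinParts ht; lia, rfl⟩,
    nodup_oddMinParts p, 2 * p.1 + 1, Multiset.mem_cons_self _ _,
    fun _ ht => le_of_mem_oddMinParts ht, ⟨p.1, rfl⟩⟩

theorem sigma_partition_ext {ν ν' : Σ n : ℕ, n.Partition} (h : ν.2.parts = ν'.2.parts) :
    ν = ν' := by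
  obtain ⟨n, parts, hpos, rfl⟩ := ν
  obtain ⟨n', parts', hpos', rfl⟩ := ν'
  obtain rfl : parts = parts' := h
  rfl

theorem pdoOfPair_bijective : Function.Bijective pdoOfPair := by
  refine ⟨fun p p' h => oddMinParts_injective
    (congrArg (fun ν : Pdo => ν.1.2.parts) h), ?_⟩
  rintro ⟨ν, hnodup, _, hmem, hmin, m, rfl⟩
  have hlt : ∀ t ∈ ν.2.parts.erase (2 * m + 1), 2 * m + 2 ≤ t := fun t ht => by
    obtain ⟨hne, ht'⟩ := hnodup.mem_erase_iff.1 ht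
    have := hmin t ht'
    lia
  have hnd : ((ν.2.parts.erase (2 * m + 1)).map (· - (2 * m + 2))).Nodup :=
    (hnodup.erase _).map_on fun x hx y hy hxy => by
      have := hlt x hx
      have := hlt y hy
      lia
  refine ⟨(m, ⟨_, hnd⟩), Subtype.ext (sigma_partition_ext ?_)⟩
  change (2 * m + 1) ::ₘ ((ν.2.parts.erase (2 * m + 1)).map (· - (2 * m + 2))).map
    (· + (2 * m + 2)) = ν.2.parts
  have hmap : ∀ t ∈ ν.2.parts.erase (2 * m + 1),
      ((· + (2 * m + 2)) ∘ (· - (2 * m + 2))) t = id t :=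
    fun t ht => Nat.sub_add_cancel (hlt t ht)
  rw [Multiset.map_map, Multiset.map_congr rfl hmap, Multiset.map_id, Multiset.cons_erase hmem]

theorem weight_pdoOfPair (α q : ℂ) (p : ℕ × Finset ℕ) :
    α ^ partitionLength (pdoOfPair p).1 * q ^ partitionSize (pdoOfPair p).1 =
      α * q ^ (2 * p.1 + 1) * ∏ i ∈ p.2, (α * q ^ (2 * p.1 + 2) * q ^ i) := by
  have hlen : partitionLength (pdoOfPair p).1 = p.2.card + 1 := by
    simp [partitionLength, pdoOfPair, oddMinParts]
  have hsize : partitionSize (pdoOfPair p).1 = 2 * p.1 + 1 + ∑ i ∈ p.2, (i + (2 * p.1 + 2)) := by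
    simp only [partitionSize, pdoOfPair, oddMinParts, Multiset.sum_cons]
    rfl
  have hprod : ∏ i ∈ p.2, (α * q ^ (2 * p.1 + 2) * q ^ i) =
      α ^ p.2.card * q ^ ∑ i ∈ p.2, (i + (2 * p.1 + 2)) := by
    rw [← Finset.prod_pow_eq_pow_sum, ← Finset.prod_const, ← Finset.prod_mul_distrib]
    exact Finset.prod_congr rfl fun i _ => by ring
  rw [hlen, hsize, hprod]
  ring

theorem summable_weight_pair {q : ℂ} (hq : ‖q‖ < 1) (α : ℂ) :
    Summable fun p : ℕ × Finset ℕ =>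
      α * q ^ (2 * p.1 + 1) * ∏ i ∈ p.2, (α * q ^ (2 * p.1 + 2) * q ^ i) := by
  have hgeom := summable_norm_mul_pow hq α
  have hsets : Summable fun s : Finset ℕ => ∏ i ∈ s, ‖α * q ^ i‖ :=
    summable_finsetProd_of_summable_nonneg (fun _ => norm_nonneg _) hgeom
  have hle : ∀ n : ℕ, ‖q‖ ^ n ≤ 1 := fun n => pow_le_one₀ (norm_nonneg q) hq.le
  refine (hgeom.mul_of_nonneg hsets (fun _ => norm_nonneg _)
    fun s => Finset.prod_nonneg fun _ _ => norm_nonneg _).of_norm_bounded fun p => ?_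
  rw [norm_mul, norm_prod]
  refine mul_le_mul ?_ (Finset.prod_le_prod (fun _ _ => norm_nonneg _) fun i _ => ?_)
    (Finset.prod_nonneg fun _ _ => norm_nonneg _) (norm_nonneg _)
  · rw [norm_mul, norm_mul, norm_pow, norm_pow]
    exact mul_le_mul_of_nonneg_left
      (pow_le_pow_of_le_one (norm_nonneg q) hq.le (by lia)) (norm_nonneg α)
  · rw [mul_right_comm, norm_mul, norm_pow]
    exact mul_le_of_le_one_right (norm_nonneg _) (hle _)

theorem summable_weight_pdo {q : ℂ} (hq : ‖q‖ < 1) (α : ℂ) :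
    Summable fun ν : Pdo => α ^ partitionLength ν.1 * q ^ partitionSize ν.1 := by
  rw [← (Equiv.ofBijective _ pdoOfPair_bijective).summable_iff]
  exact (summable_weight_pair hq α).congr fun p => (weight_pdoOfPair α q p).symm

theorem tsum_weight_pdo (α q : ℂ) :
    ∑' ν : Pdo, α ^ partitionLength ν.1 * q ^ partitionSize ν.1 =
      ∑' p : ℕ × Finset ℕ,
        α * q ^ (2 * p.1 + 1) * ∏ i ∈ p.2, (α * q ^ (2 * p.1 + 2) * q ^ i) := by
  rw [← (Equiv.ofBijective _ pdoOfPair_bijective).tsum_eq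
    fun ν : Pdo => α ^ partitionLength ν.1 * q ^ partitionSize ν.1]
  exact tsum_congr fun p => weight_pdoOfPair α q p

theorem hasSum_prod_mul_pow {q : ℂ} (hq : ‖q‖ < 1) (x : ℂ) :
    HasSum (fun s : Finset ℕ => ∏ i ∈ s, (x * q ^ i)) (qPochInf (-x) q) := by
  have hsets : Summable fun s : Finset ℕ => ∏ i ∈ s, (x * q ^ i) :=
    summable_finsetProd_of_summable_norm (summable_norm_mul_pow hq x)
  rw [qPochInf_neg, tprod_one_add hsets]
  exact hsets.hasSum

/-- Sorting the partitions in `P_do` by their smallest part `2m+1`. -/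
theorem hasSum_mul_qPochInf {q : ℂ} (hq : ‖q‖ < 1) (α : ℂ) :
    HasSum (fun m : ℕ => α * q ^ (2 * m + 1) * qPochInf (-(α * q ^ (2 * m + 2))) q)
      (∑' ν : Pdo, α ^ partitionLength ν.1 * q ^ partitionSize ν.1) := by
  rw [tsum_weight_pdo]
  have hpair := (summable_weight_pair hq α).hasSum
  have hfib (m : ℕ) := (hasSum_prod_mul_pow hq (α * q ^ (2 * m + 2))).mul_left
    (α * q ^ (2 * m + 1))
  exact hpair.prod_fiberwise hfib

theorem theorem5p4 (α q : ℂ) (hq : ‖q‖ < 1)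
    (hα : ∀ n : ℕ, 1 + α * q ^ (2 * n + 1) ≠ 0) :
    Multipliable (fun n : ℕ => 1 - (-α) * q ^ n) ∧
    Summable (fun n : ℕ => psiTerm (-α * q) (-q) (n + 1)) ∧
    Summable (fun ν : Pdo => α ^ partitionLength ν.1 * q ^ partitionSize ν.1) ∧
    Summable (fun k : ℕ => (-1 : ℂ) ^ (k + 1) * q ^ ((k + 1) ^ 2)) ∧
    qPochInf (-α) q * psi (-α * q) (-q) =
      -(∑' ν : Pdo, α ^ partitionLength ν.1 * q ^ partitionSize ν.1) +
        ∑' k : ℕ, (-1 : ℂ) ^ (k + 1) * q ^ ((k + 1) ^ 2) := by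
  refine ⟨multipliable_one_sub_neg_mul_pow hq α,
    (summable_nat_add_iff 1).2 (summable_psiTerm hq α), summable_weight_pdo hq α, ?_, ?_⟩
  · -- The theta series is the case `α = 0` of `ψ(-αq;-q)`.
    have h := (summable_nat_add_iff 1).2 (summable_psiTerm hq 0)
    exact h.congr fun k => by
      rw [psiTerm_eq]
      simp
  · have h := tendsto_nhds_unique (hasSum_mul_qPochInf hq α).tendsto_sum_nat
      (tendsto_sum_range_mul_qPochInf hq hα)
    rw [h]
    ring
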